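/- Let $R$ be a Noetherian local ring with algebraically closed residue field $k$. Assume that $R$ is universally catenary and equidimensional, i.e. $\dim R/\mathfrak p=\dim R$ for every minimal prime $\mathfrak p$ of $R$. Let $M$ be a finitely generated $R$-module of rank $e$, i.e. $M\otimes_R K$ is a free $K$-module of rank $e$, where $K$ is the total ring of quotients of $R$. Let $n=\mu(M)$ be the minimal number of generators of $M$ and set $r=n-e$. Let $\mathcal R(M)$ be the Rees algebra of $M$, that is, the symmetric algebra $\mathrm{Sym}_R(M)$ modulo its $R$-torsion (the elements annihilated by a nonzerodivisor of $R$), with the grading induced by that of $\mathrm{Sym}_R(M)$, and let $$s=s(M)=\dim_k\big[(\mathcal R(M)\otimes_R k)/\sqrt 0\,\big]_1$$ be the dimension of the degree-one part of its special fiber modulo the nilradical. Then there exists a minimal presentation matrix $\varphi$ of $M$, i.e. an $n\times m$ matrix with an exact sequence $R^m\xrightarrow{\varphi}R^n\to M\to 0$ in which $n=\mu(M)$ and $m=\mu(\operatorname{im}\varphi)$, that has $s$ rows such that for each of them the ideal of $R$ generated by the entries of that row has height at most $r$. -/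

import Mathlib

open scoped TensorProduct

noncomputable section

/-- A commutative ring is catenary if, for any primes `p ⊆ q`, the chains of primes from `p` to `q`
have bounded length and all saturated ones (each step a covering) have the same length. -/
def IsCatenaryRing (S : Type*) [CommRing S] : Prop :=
  ∀ p q : PrimeSpectrum S, p ≤ q → ∃ N : ℕ,
    (∀ c : LTSeries (PrimeSpectrum S), c.head = p → c.last = q → c.length ≤ N) ∧
    (∀ c : RelSeries {x : PrimeSpectrum S × PrimeSpectrum S | x.1 ⋖ x.2},
      c.head = p → c.last = q → c.length = N)

/-- Every algebra of finite type over `R` is catenary. (Up to isomorphism, all of these live in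
the universe of `R`.) -/
def IsUniversallyCatenaryRing.{u} (R : Type u) [CommRing R] : Prop :=
  ∀ (S : Type u) [CommRing S] [Algebra R S], Algebra.FiniteType R S → IsCatenaryRing S

/-- All irreducible components of `Spec R` have dimension `dim R`. -/
def IsEquidimensionalRing (R : Type*) [CommRing R] : Prop :=
  ∀ p ∈ minimalPrimes R, ringKrullDim (R ⧸ p) = ringKrullDim R

section Modules

variable (R : Type*) [CommRing R] (M : Type*) [AddCommGroup M] [Module R M]

/-- `M` has rank `e`: with `K` the total ring of quotients of `R` (that is, `R` localized at its
nonzerodivisors), `M ⊗ K` is a free `K`-module of rank `e`. -/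
def ModuleHasRank (e : ℕ) : Prop :=
  Nonempty ((FractionRing R ⊗[R] M) ≃ₗ[FractionRing R] (Fin e → FractionRing R))

/-- The minimal number of generators `μ(M)` (of a finitely generated module). -/
def minGens : ℕ := (⊤ : Submodule R M).spanFinrank

/-- The `R`-torsion of `Sym(M)`: the elements killed by some nonzerodivisor of `R`. -/
def symTorsionIdeal : Ideal (SymmetricAlgebra R M) where
  carrier := {x | ∃ a ∈ nonZeroDivisors R, a • x = 0}
  zero_mem' := ⟨1, one_mem _, smul_zero _⟩
  add_mem' := by
    rintro x y ⟨a, ha, hx⟩ ⟨b, hb, hy⟩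
    refine ⟨a * b, mul_mem ha hb, ?_⟩
    rw [smul_add, mul_comm a b, mul_smul, hx, mul_comm b a, mul_smul, hy]
    simp
  smul_mem' := by
    rintro c x ⟨a, ha, hx⟩
    exact ⟨a, ha, by rw [smul_eq_mul, ← mul_smul_comm, hx, mul_zero]⟩

/-- The Rees algebra of a module having a rank: `Sym(M)` modulo its `R`-torsion. -/
abbrev ModuleReesAlgebra : Type _ := SymmetricAlgebra R M ⧸ symTorsionIdeal R M

variable [IsLocalRing R]

/-- The special fiber of the Rees algebra, an algebra over the residue field of `R`. -/
def SpecialFiber : Type _ := IsLocalRing.ResidueField R ⊗[R] ModuleReesAlgebra R M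

instance : CommRing (SpecialFiber R M) :=
  inferInstanceAs (CommRing (IsLocalRing.ResidueField R ⊗[R] ModuleReesAlgebra R M))

instance : Algebra (IsLocalRing.ResidueField R) (SpecialFiber R M) :=
  inferInstanceAs (Algebra (IsLocalRing.ResidueField R)
    (IsLocalRing.ResidueField R ⊗[R] ModuleReesAlgebra R M))

/-- The degree-one element of the special fiber given by a module element. -/
def toSpecialFiber (x : M) : SpecialFiber R M :=
  (1 ⊗ₜ[R] (Ideal.Quotient.mk (symTorsionIdeal R M) (SymmetricAlgebra.ι R M x)) :
    IsLocalRing.ResidueField R ⊗[R] ModuleReesAlgebra R M)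

/-- The special fiber of the Rees algebra modulo its nilradical. -/
abbrev ReducedSpecialFiber : Type _ := SpecialFiber R M ⧸ nilradical (SpecialFiber R M)

/-- The degree-one part of the reduced special fiber, for the grading induced by that of `Sym(M)`.
As the degree-one part of `Sym(M)` is `M`, it is spanned by the classes of the elements of `M`. -/
def reducedSpecialFiberDegreeOne : Submodule (IsLocalRing.ResidueField R)
    (ReducedSpecialFiber R M) :=
  Submodule.span _ (Set.range fun x : M =>
    Ideal.Quotient.mk (nilradical (SpecialFiber R M)) (toSpecialFiber R M x))

/-- The invariant `s(M)`. -/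
def reducedFiberRank : ℕ :=
  Module.finrank (IsLocalRing.ResidueField R) (reducedSpecialFiberDegreeOne R M)

end Modules

/-- The `n × m` matrix `φ` is a minimal presentation matrix of `M`: there is an exact sequence
`R^m → R^n → M → 0` whose first map is `φ`, with `n = μ(M)` and with the `m` columns of `φ` a
minimal generating set of the module of relations. -/
def IsMinimalPresentationMatrix {R : Type*} [CommRing R] (M : Type*) [AddCommGroup M] [Module R M]
    {n m : ℕ} (φ : Matrix (Fin n) (Fin m) R) : Prop :=
  (∃ π : (Fin n → R) →ₗ[R] M, Function.Exact φ.mulVecLin π ∧ Function.Surjective π) ∧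
    n = minGens R M ∧ m = minGens R (LinearMap.range φ.mulVecLin)

/-- The ideal generated by the entries of the `i`-th row. -/
def matrixRowIdeal {R : Type*} [CommRing R] {n m : ℕ} (φ : Matrix (Fin n) (Fin m) R) (i : Fin n) :
    Ideal R :=
  Ideal.span (Set.range (φ i))

end

/-! The `k`-points of the special fiber restrict to linear forms on `k ⊗ M`. By the Nullstellensatz
their common kernel is the part of `k ⊗ M` that becomes nilpotent, so they span a space of dimension
`s`. Choose `s` independent ones, complete them to a basis of the dual, and lift the dual basis to
minimal generators `x_j` of `M` (`exists_generators_with_points`). Then `s` indices `i` carry a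
point of the Rees algebra with coordinates `δ_ij`.

It remains to bound the `i`-th row ideal `I` (`height_add_rank_le`). The point lies on a component
of the Rees algebra over some minimal prime `p`. With `D = R/p`, this component is `D[X_1, ...,
X_n]/q`, where `ht q ≤ n - e`, and the point is a prime `Q ⊇ q` of height `dim D + n`. Catenarity
gives `ht (Q/q) ≥ dim D + n - ht q`. Cutting the component by the `n` equations `X_j = δ_ij` leaves
a quotient of `R/I`, because the relations among the `x_j` specialize to the entries of row `i`; so
`ht (Q/q) ≤ dim R/I + n`. Since `dim D = dim R ≥ ht I + dim R/I`, it follows that `ht I ≤ ht q ≤ n -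
e`. -/

/-! ### Chains of primes, catenarity and heights. -/

theorem wellFoundedLT_primeSpectrum (T : Type*) [CommRing T] [IsNoetherianRing T] :
    WellFoundedLT (PrimeSpectrum T) := by
  have : StrictMono fun q : PrimeSpectrum T => q.asIdeal.height.toNat := by
    intro p q hpq
    have h := Ideal.height_strict_mono_of_isPrime_of_isPrime
      (I := p.asIdeal) (J := q.asIdeal) hpq
    have hp := Ideal.height_ne_top_of_isPrime (I := p.asIdeal)
    have hq := Ideal.height_ne_top_of_isPrime (I := q.asIdeal)
    lift p.asIdeal.height to ℕ using hp with a
    lift q.asIdeal.height to ℕ using hq with b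
    simpa using h
  exact this.wellFoundedLT

theorem wellFoundedGT_primeSpectrum (T : Type*) [CommRing T] [IsNoetherianRing T] :
    WellFoundedGT (PrimeSpectrum T) :=
  (show StrictMono (PrimeSpectrum.asIdeal (R := T)) from fun _ _ h => h).wellFoundedGT

theorem exists_covBy_relSeries {α : Type*} [PartialOrder α] [WellFoundedLT α] [WellFoundedGT α]
    {x y : α} (h : x ≤ y) :
    ∃ c : RelSeries {x : α × α | x.1 ⋖ x.2}, c.head = x ∧ c.last = y := by
  obtain ⟨a, h0, n, hn, ha⟩ := exists_covBy_seq_of_wellFoundedLT_wellFoundedGT_of_le h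
  exact ⟨⟨n, fun i => a i, fun i => ha i i.2⟩, h0, hn⟩

theorem covBy_relSeries_length_le_height {T : Type*} [CommRing T]
    (c : RelSeries {x : PrimeSpectrum T × PrimeSpectrum T | x.1 ⋖ x.2}) :
    (c.length : ℕ∞) ≤ c.last.asIdeal.height := by
  rw [PrimeSpectrum.height_eq_orderHeight]
  let s : LTSeries (PrimeSpectrum T) := ⟨c.length, c, fun i => (c.step i).lt⟩
  exact Order.length_le_height (p := s) (x := c.last) le_rfl

theorem exists_ltSeries_head_eq_bot {T : Type*} [CommRing T] [IsDomain T] [IsNoetherianRing T]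
    (Q : PrimeSpectrum T) : ∃ c : LTSeries (PrimeSpectrum T), c.head = ⊥ ∧ c.last = Q ∧
      Q.asIdeal.height ≤ c.length := by
  obtain ⟨c, hc, hlen⟩ := Q.asIdeal.exists_ltSeries_length_eq_height
  by_cases h : c.head = ⊥
  · exact ⟨c, h, hc, hlen.ge⟩
  · refine ⟨c.cons ⊥ (bot_lt_iff_ne_bot.mpr h), by simp, by simpa using hc, ?_⟩
    rw [← hlen]; simp

/-- A saturated chain from `⊥` to `q` followed by one from `q` to `Q` has the common length `N`,
which also bounds a chain realizing `Q.height`. -/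
theorem height_le_height_add_of_isCatenaryRing {T : Type*} [CommRing T] [IsDomain T]
    [IsNoetherianRing T] (hT : IsCatenaryRing T) (q Q : Ideal T) [q.IsPrime] [Q.IsPrime]
    (h : q ≤ Q) :
    Q.height ≤ q.height + (Q.map (Ideal.Quotient.mk q)).height := by
  have := wellFoundedLT_primeSpectrum T
  have := wellFoundedLT_primeSpectrum (T ⧸ q)
  have := wellFoundedGT_primeSpectrum T
  have := wellFoundedGT_primeSpectrum (T ⧸ q)
  have hQ' : (Q.map (Ideal.Quotient.mk q)).IsPrime := Ideal.isPrime_map_quotientMk_of_isPrime h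
  obtain ⟨N, hN, hsat⟩ := hT ⊥ ⟨Q, inferInstance⟩ bot_le
  obtain ⟨c₁, h₁, h₁'⟩ := exists_covBy_relSeries (bot_le (a := (⟨q, inferInstance⟩ : PrimeSpectrum T)))
  obtain ⟨c₂, h₂, h₂'⟩ := exists_covBy_relSeries
    (bot_le (a := (⟨_, hQ'⟩ : PrimeSpectrum (T ⧸ q))))
  let f : PrimeSpectrum (T ⧸ q) ↪o PrimeSpectrum T :=
    OrderEmbedding.ofMapLEIff (PrimeSpectrum.comap (Ideal.Quotient.mk q)) fun a b =>
      Ideal.comap_le_comap_iff_of_surjective _ Ideal.Quotient.mk_surjective _ _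
  -- The image is the up-set of `q`, so coverings in `T ⧸ q` remain coverings in `T`.
  have hf : (Set.range f).OrdConnected := by
    have : Set.range f = Set.Ici ⟨q, inferInstance⟩ := by
      ext P
      constructor
      · rintro ⟨P, rfl⟩ x hx
        change Ideal.Quotient.mk q x ∈ P.asIdeal
        simp [Ideal.Quotient.eq_zero_iff_mem.mpr hx]
      · intro hP
        refine ⟨⟨_, Ideal.isPrime_map_quotientMk_of_isPrime hP⟩, PrimeSpectrum.ext ?_⟩
        change Ideal.comap _ (Ideal.map _ _) = _
        rw [Ideal.comap_map_mk hP]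
    rw [this]; exact Set.ordConnected_Ici
  let g : RelSeries {x : PrimeSpectrum (T ⧸ q) × PrimeSpectrum (T ⧸ q) | x.1 ⋖ x.2} →
      RelSeries {x : PrimeSpectrum T × PrimeSpectrum T | x.1 ⋖ x.2} := fun c =>
    ⟨c.length, f ∘ c, fun i => CovBy.image f (c.step i) hf⟩
  have hhead : c₁.last = (g c₂).head := by
    rw [h₁']
    change _ = f c₂.head
    rw [h₂]
    refine PrimeSpectrum.ext ?_
    change q = Ideal.comap _ ⊥
    rw [← RingHom.ker_eq_comap_bot, Ideal.mk_ker]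
  have hlast : (g c₂).last = ⟨Q, inferInstance⟩ := by
    change f c₂.last = _
    rw [h₂']
    refine PrimeSpectrum.ext ?_
    change Ideal.comap _ (Ideal.map _ _) = _
    rw [Ideal.comap_map_mk h]
  have hlen := hsat (c₁.smash (g c₂) hhead) (by simpa using h₁) (by simpa using hlast)
  have hlen' : c₁.length + c₂.length = N := hlen
  obtain ⟨c, hc, hc', hcl⟩ := exists_ltSeries_head_eq_bot (⟨Q, inferInstance⟩ : PrimeSpectrum T)
  calc Q.height ≤ c.length := hcl
    _ ≤ N := by exact_mod_cast hN c hc hc'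
    _ = c₁.length + c₂.length := by rw [← hlen']; push_cast; rfl
    _ ≤ _ := by
      gcongr
      · simpa [h₁'] using covBy_relSeries_length_le_height c₁
      · simpa [h₂'] using covBy_relSeries_length_le_height c₂

/-- The kernel is maximal and lies over the analogous kernel in one variable fewer, so each variable
raises the height by exactly one. -/
theorem height_ker_mvPolynomial {R k : Type*} [CommRing R] [IsNoetherianRing R] [Field k]
    [Algebra R k] (hk : Function.Surjective (algebraMap R k)) (n : ℕ)
    (f : MvPolynomial (Fin n) R →ₐ[R] k) :
    (RingHom.ker f).height = (RingHom.ker (algebraMap R k)).height + n := by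
  induction n with
  | zero =>
    let e := MvPolynomial.isEmptyAlgEquiv R (Fin 0)
    have : RingHom.ker f = (RingHom.ker (algebraMap R k)).comap e.toRingEquiv := by
      ext x
      have : f x = algebraMap R k (e x) := by
        rw [← f.commutes]
        exact congrArg f (e.injective (e.commutes (e x)).symm)
      simp [RingHom.mem_ker, this]
    rw [this, RingEquiv.height_comap]; simp
  | succ n ih =>
    let e := MvPolynomial.finSuccEquiv R n
    let g : Polynomial (MvPolynomial (Fin n) R) →ₐ[R] k := f.comp e.symm.toAlgHom
    have hg : Function.Surjective g := fun y => by
      obtain ⟨r, rfl⟩ := hk y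
      exact ⟨algebraMap _ _ r, g.commutes r⟩
    have h1 : RingHom.ker f = (RingHom.ker g).comap e.toRingEquiv := by
      ext x; simp [RingHom.mem_ker, g]
    let g' : MvPolynomial (Fin n) R →ₐ[R] k :=
      g.comp (IsScalarTower.toAlgHom R (MvPolynomial (Fin n) R) _)
    have : (RingHom.ker g).IsMaximal := RingHom.ker_isMaximal_of_surjective g hg
    have : (RingHom.ker g).LiesOver (RingHom.ker g') := ⟨by ext; simp [g', RingHom.mem_ker]⟩
    rw [h1, RingEquiv.height_comap, Polynomial.height_eq_height_add_one (RingHom.ker g'), ih]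
    push_cast
    rw [add_assoc]

/-- A chain of primes containing `I` can be prolonged downwards by a chain realizing the height of
its bottom prime, which is at least `I.height`. -/
theorem height_add_ringKrullDim_quotient_le {R : Type*} [CommRing R] [IsNoetherianRing R]
    (I : Ideal R) : (I.height : WithBot ℕ∞) + ringKrullDim (R ⧸ I) ≤ ringKrullDim R := by
  have key : ∀ l : LTSeries (PrimeSpectrum (R ⧸ I)),
      (I.height : WithBot ℕ∞) + (l.length : WithBot ℕ∞) ≤ ringKrullDim R := by
    intro l
    let l' := l.map (PrimeSpectrum.comap (Ideal.Quotient.mk I))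
        (RingHom.strictMono_comap_of_surjective Ideal.Quotient.mk_surjective)
    have hI : I ≤ l'.head.asIdeal := by
      intro x hx
      simp [l', Ideal.Quotient.eq_zero_iff_mem.mpr hx]
    obtain ⟨c, hc, hlen⟩ := l'.head.asIdeal.exists_ltSeries_length_eq_height
    have : (c.smash l' hc).length = c.length + l.length := rfl
    calc _ ≤ (l'.head.asIdeal.height : WithBot ℕ∞) + (l.length : WithBot ℕ∞) := by
          gcongr
          exact WithBot.coe_le_coe.mpr (Ideal.height_mono hI)
      _ = ((c.smash l' hc).length : WithBot ℕ∞) := by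
          rw [this, ← hlen]; push_cast; rfl
      _ ≤ _ := Order.LTSeries.length_le_krullDim _
  rcases subsingleton_or_nontrivial (R ⧸ I) with h | h
  · simp [ringKrullDim_eq_bot_of_subsingleton]
  have : Nontrivial R := (Ideal.Quotient.mk I).domain_nontrivial
  obtain ⟨d, hd⟩ := WithBot.ne_bot_iff_exists.mp
    (ne_bot_of_le_ne_bot WithBot.coe_ne_bot (ringKrullDim_nonneg_of_nontrivial (R := R)))
  rw [ringKrullDim, Order.krullDim_eq_iSup_length, ← hd, ← WithBot.coe_add, WithBot.coe_le_coe,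
    ENat.add_iSup]
  refine iSup_le fun l => ?_
  have := key l
  rw [← hd] at this
  exact_mod_cast this

/-! ### Components of the Rees algebra over the minimal primes of `R`. -/

/-- The linear form with the given coefficients. -/
noncomputable def linearForm (L : Type*) [CommRing L] (e : ℕ) :
    (Fin e → L) →ₗ[L] MvPolynomial (Fin e) L :=
  Fintype.linearCombination L MvPolynomial.X

section

variable {R M L : Type*} [CommRing R] [AddCommGroup M] [Module R M] [CommRing L] [Algebra R L]
  {e : ℕ}

/-- The map on the symmetric algebra induced by a linear map to a free module. -/
noncomputable def symToMvPolynomial (g : M →ₗ[R] (Fin e → L)) :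
    SymmetricAlgebra R M →ₐ[R] MvPolynomial (Fin e) L :=
  SymmetricAlgebra.lift ((linearForm L e).restrictScalars R ∘ₗ g)

@[simp]
theorem symToMvPolynomial_ι (g : M →ₗ[R] (Fin e → L)) (x : M) :
    symToMvPolynomial g (SymmetricAlgebra.ι R M x) = linearForm L e (g x) := by
  simp [symToMvPolynomial]

theorem map_symToMvPolynomial {L' : Type*} [CommRing L'] [Algebra R L'] (θ : L →ₐ[R] L')
    (g : M →ₗ[R] (Fin e → L)) (x : SymmetricAlgebra R M) :
    MvPolynomial.map θ.toRingHom (symToMvPolynomial g x) =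
      symToMvPolynomial (θ.toLinearMap.compLeft (Fin e) ∘ₗ g) x := by
  have : (MvPolynomial.mapAlgHom (σ := Fin e) θ).comp (symToMvPolynomial g) =
      symToMvPolynomial (θ.toLinearMap.compLeft (Fin e) ∘ₗ g) := by
    apply SymmetricAlgebra.algHom_ext
    ext x
    simp [linearForm, Fintype.linearCombination_apply, MvPolynomial.smul_eq_C_mul]
  exact DFunLike.congr_fun this x

end

/-- The basis of `K ⊗ M` yields a map from the polynomial ring back to `K ⊗ Sym(M)`. Composing the
two gives the localization map, whose kernel is the torsion. -/
theorem mem_symTorsionIdeal_of_symToMvPolynomial_eq_zero {R M : Type*} [CommRing R]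
    [AddCommGroup M] [Module R M] {e : ℕ}
    (b : (FractionRing R ⊗[R] M) ≃ₗ[FractionRing R] (Fin e → FractionRing R))
    (x : SymmetricAlgebra R M)
    (hx : symToMvPolynomial (b.toLinearMap.restrictScalars R ∘ₗ
      TensorProduct.mk R (FractionRing R) M 1) x = 0) : x ∈ symTorsionIdeal R M := by
  let K := FractionRing R
  let u : (K ⊗[R] M) →ₗ[K] (K ⊗[R] SymmetricAlgebra R M) :=
    (SymmetricAlgebra.ι R M).baseChange K
  let h : MvPolynomial (Fin e) K →ₐ[K] K ⊗[R] SymmetricAlgebra R M :=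
    MvPolynomial.aeval fun i => u (b.symm (Pi.single i 1))
  have hh : ∀ v, h (linearForm K e v) = u (b.symm v) := by
    intro v
    conv_rhs => rw [pi_eq_sum_univ' v]
    simp [h, linearForm, Fintype.linearCombination_apply, Pi.single]
  have hcomp : (h.restrictScalars R).comp (symToMvPolynomial (b.toLinearMap.restrictScalars R ∘ₗ
      TensorProduct.mk R (FractionRing R) M 1)) =
      Algebra.TensorProduct.includeRight := by
    apply SymmetricAlgebra.algHom_ext
    ext m
    simp [hh, u]
  have hx' : (1 : K) ⊗ₜ[R] x = 0 := by
    have := DFunLike.congr_fun hcomp x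
    simpa [hx] using this.symm
  have : IsLocalizedModule (nonZeroDivisors R) (TensorProduct.mk R K (SymmetricAlgebra R M) 1) :=
    (isLocalizedModule_iff_isBaseChange (nonZeroDivisors R) K _).mpr
      (TensorProduct.isBaseChange R _ K)
  obtain ⟨a, ha⟩ := (IsLocalizedModule.eq_zero_iff (nonZeroDivisors R)
    (TensorProduct.mk R K (SymmetricAlgebra R M) 1)).mp hx'
  exact ⟨a, a.2, ha⟩

section

variable {R : Type*} [CommRing R]

/-- The map from the total ring of quotients to the residue field at a minimal prime. -/
noncomputable def fractionRingToQuotient {p : Ideal R} (hp : p ∈ minimalPrimes R) :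
    FractionRing R →ₐ[R] FractionRing (R ⧸ p) :=
  have := hp.1.1
  IsLocalization.liftAlgHom (M := nonZeroDivisors R)
    (f := Algebra.ofId R (FractionRing (R ⧸ p))) fun y => by
      rw [isUnit_iff_ne_zero]
      change algebraMap R _ _ ≠ 0
      rw [IsScalarTower.algebraMap_apply R (R ⧸ p), Ne, FaithfulSMul.algebraMap_eq_zero_iff]
      intro h
      exact Set.disjoint_left.mp (Ideal.disjoint_nonZeroDivisors_of_mem_minimalPrimes hp)
        (Ideal.Quotient.eq_zero_iff_mem.mp h) y.2

theorem isNilpotent_of_fractionRingToQuotient_eq_zero (y : FractionRing R)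
    (hy : ∀ p (hp : p ∈ minimalPrimes R), fractionRingToQuotient hp y = 0) : IsNilpotent y := by
  obtain ⟨a, s, rfl⟩ := IsLocalization.exists_mk'_eq (nonZeroDivisors R) y
  have ha : IsNilpotent a := by
    rw [← mem_nilradical, nilradical, ← Ideal.sInf_minimalPrimes, Ideal.mem_sInf]
    intro p hp
    have := hp.1.1
    have h := hy p hp
    have h2 : fractionRingToQuotient hp (algebraMap R _ a) = 0 := by
      rw [← IsLocalization.mk'_spec _ a s, map_mul, h, zero_mul]
    rw [AlgHom.commutes, IsScalarTower.algebraMap_apply R (R ⧸ p),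
      FaithfulSMul.algebraMap_eq_zero_iff] at h2
    exact Ideal.Quotient.eq_zero_iff_mem.mp h2
  rw [IsLocalization.mk'_eq_mul_mk'_one]
  exact Commute.isNilpotent_mul_right (Commute.all _ _) (ha.map (algebraMap R (FractionRing R)))

/-- An element in all these kernels has nilpotent image over the total ring of quotients, so a power
of it is torsion. The finite intersection of the kernels thus lies in the prime `RingHom.ker α`,
hence one of them does. -/
theorem exists_minimalPrime_ker_symToMvPolynomial_le [IsNoetherianRing R] {M F : Type*}
    [AddCommGroup M] [Module R M] {e : ℕ} (he : ModuleHasRank R M e) [CommRing F] [IsDomain F]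
    [Algebra R F] (α : SymmetricAlgebra R M →ₐ[R] F)
    (hα : symTorsionIdeal R M ≤ RingHom.ker α) :
    ∃ p ∈ minimalPrimes R, ∃ g : M →ₗ[R] (Fin e → FractionRing (R ⧸ p)),
      Submodule.span (FractionRing (R ⧸ p)) (Set.range g) = ⊤ ∧
      RingHom.ker (symToMvPolynomial g) ≤ RingHom.ker α := by
  obtain ⟨b⟩ := he
  let g₀ : M →ₗ[R] (Fin e → FractionRing R) := b.toLinearMap.restrictScalars R ∘ₗ
      TensorProduct.mk R (FractionRing R) M 1
  let g (p : minimalPrimes R) : M →ₗ[R] (Fin e → FractionRing (R ⧸ p.1)) :=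
    (fractionRingToQuotient p.2).toLinearMap.compLeft (Fin e) ∘ₗ g₀
  have hfin := (minimalPrimes.finite_of_isNoetherianRing R).fintype
  have hinf : (Finset.univ.inf fun p : minimalPrimes R =>
      RingHom.ker (symToMvPolynomial (g p))) ≤ RingHom.ker α := by
    intro x hx
    have hx' : ∀ p, symToMvPolynomial (g p) x = 0 := fun p =>
      Finset.inf_le (f := fun p => RingHom.ker (symToMvPolynomial (g p))) (Finset.mem_univ p) hx
    have hnil : IsNilpotent (symToMvPolynomial g₀ x) := by
      rw [MvPolynomial.isNilpotent_iff]
      refine fun i => isNilpotent_of_fractionRingToQuotient_eq_zero _ fun p hp => ?_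
      have h := hx' ⟨p, hp⟩
      rw [← map_symToMvPolynomial] at h
      have h2 := congrArg (MvPolynomial.coeff i) h
      rwa [MvPolynomial.coeff_map] at h2
    obtain ⟨N, hN⟩ := hnil
    rw [← map_pow] at hN
    have := hα (mem_symTorsionIdeal_of_symToMvPolynomial_eq_zero b _ hN)
    exact Ideal.IsPrime.mem_of_pow_mem (RingHom.ker_isPrime α) _ this
  obtain ⟨p, -, hp⟩ := (Ideal.IsPrime.inf_le' (RingHom.ker_isPrime α)).mp hinf
  refine ⟨p.1, p.2, g p, ?_, hp⟩
  have hmem : ∀ t, (fractionRingToQuotient p.2).toLinearMap.compLeft (Fin e) (b t) ∈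
      Submodule.span (FractionRing (R ⧸ p.1)) (Set.range (g p)) := by
    intro t
    induction t with
    | zero => simp
    | tmul a m =>
      have : (fractionRingToQuotient p.2).toLinearMap.compLeft (Fin e) (b (a ⊗ₜ m)) =
          fractionRingToQuotient p.2 a • g p m := by
        have h1 : b (a ⊗ₜ m) = a • g₀ m := by
          change _ = a • b (1 ⊗ₜ m)
          rw [← map_smul, TensorProduct.smul_tmul', smul_eq_mul, mul_one]
        rw [h1]
        ext i
        exact map_mul (fractionRingToQuotient p.2) a (g₀ m i)
      rw [this]
      exact Submodule.smul_mem _ _ (Submodule.subset_span ⟨m, rfl⟩)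
    | add x y hx hy => rw [map_add, map_add]; exact add_mem hx hy
  rw [← top_le_iff, ← (Pi.basisFun (FractionRing (R ⧸ p.1)) (Fin e)).span_eq, Submodule.span_le]
  rintro _ ⟨i, rfl⟩
  convert! hmem (b.symm (Pi.single i 1))
  ext j
  rcases eq_or_ne j i with rfl | h <;> simp [*]

end

-- The height bound at a point of the Rees algebra.

-- The ideal is contracted from the localization at the nonzero constants, which preserves its
-- height. Over the fraction field the map is onto a polynomial ring of dimension `e`.
attribute [local instance] MvPolynomial.algebraMvPolynomial in
theorem height_ker_aeval_linearForm_add_le {D : Type*} [CommRing D] [IsDomain D]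
    [IsNoetherianRing D] {n e : ℕ} (v : Fin n → Fin e → FractionRing D)
    (hv : Submodule.span (FractionRing D) (Set.range v) = ⊤) :
    (RingHom.ker (MvPolynomial.aeval (R := D) fun j => linearForm _ e (v j))).height + e ≤ n := by
  let κ := FractionRing D
  let f : MvPolynomial (Fin n) κ →ₐ[κ] MvPolynomial (Fin e) κ :=
    MvPolynomial.aeval fun j => linearForm _ e (v j)
  have hf : Function.Surjective f := by
    rw [← AlgHom.range_eq_top, ← top_le_iff, ← MvPolynomial.adjoin_range_X,
      Algebra.adjoin_le_iff]
    rintro _ ⟨i, rfl⟩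
    have h1 : ∀ w, linearForm κ e w ∈ f.range := by
      intro w
      have hw : w ∈ Submodule.span κ (Set.range v) := hv ▸ Submodule.mem_top
      induction hw using Submodule.span_induction with
      | mem x hx => obtain ⟨j, rfl⟩ := hx; exact ⟨MvPolynomial.X j, by simp [f]⟩
      | zero => simp
      | add x y _ _ hx hy => rw [map_add]; exact add_mem hx hy
      | smul a x _ hx => rw [map_smul]; exact Subalgebra.smul_mem _ hx a
    simpa [linearForm] using h1 (Pi.single i 1)
  have hker : RingHom.ker (MvPolynomial.aeval (R := D) fun j => linearForm κ e (v j)) =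
      (RingHom.ker f).under (MvPolynomial (Fin n) D) := by
    ext x
    rw [Ideal.under_def, Ideal.mem_comap, RingHom.mem_ker, RingHom.mem_ker,
      ← MvPolynomial.aeval_map_algebraMap κ]
    rfl
  rw [hker, IsLocalization.height_under ((nonZeroDivisors D).map MvPolynomial.C)]
  have := height_add_ringKrullDim_quotient_le (RingHom.ker f)
  rw [ringKrullDim_eq_of_ringEquiv (RingHom.quotientKerEquivOfSurjective hf),
    MvPolynomial.ringKrullDim_of_isNoetherianRing, MvPolynomial.ringKrullDim_of_isNoetherianRing,
    ringKrullDim_eq_zero_of_field] at this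
  simp only [zero_add, Nat.card_eq_fintype_card, Fintype.card_fin] at this
  exact_mod_cast this

theorem rank_arith {hm hq hQ' hI : ℕ∞} {ρ : WithBot ℕ∞} {e n : ℕ} (hfin : hm ≠ ⊤)
    (h1 : hq + e ≤ n) (h2 : hm + n ≤ hq + hQ') (h3 : (hQ' : WithBot ℕ∞) ≤ ρ + n)
    (h4 : hI + ρ ≤ (hm : WithBot ℕ∞)) : hI + e ≤ n := by
  cases ρ with
  | bot => simp at h3
  | coe ρ =>
    have h3' : hQ' ≤ ρ + n := by exact_mod_cast h3
    have h4' : hI + ρ ≤ hm := by exact_mod_cast h4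
    lift hm to ℕ using hfin
    have hI' : hI ≠ ⊤ := by rintro rfl; simp at h4'
    have hρ' : ρ ≠ ⊤ := by rintro rfl; simp at h4'
    have hq' : hq ≠ ⊤ := by rintro rfl; simp at h1
    lift hI to ℕ using hI'
    lift ρ to ℕ using hρ'
    lift hq to ℕ using hq'
    have hQ : hQ' ≠ ⊤ := by
      rintro rfl
      exact absurd h3' (by simp)
    lift hQ' to ℕ using hQ
    norm_cast at *
    omega

/-- Modulo the `n` elements `X j - c j` of `Q`, the ring `B` becomes a quotient of `R`, and each
linear relation among the `X j` forces an element of `I` to vanish. The generalized Krull height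
theorem then applies. -/
theorem height_le_ringKrullDim_quotient_add_of_linear {R B : Type*} [CommRing R] [CommRing B]
    [IsNoetherianRing B] [Algebra R B] {n : ℕ} (X : Fin n → B)
    (hX : Algebra.adjoin R (Set.range X) = ⊤) (c : Fin n → R) (Q : Ideal B) [Q.IsPrime]
    (hQ : ∀ j, X j - algebraMap R B (c j) ∈ Q) (I : Ideal R)
    (hI : ∀ b ∈ I, ∃ r : Fin n → R, ∑ j, r j • X j = 0 ∧ ∑ j, r j * c j = b) :
    (Q.height : WithBot ℕ∞) ≤ ringKrullDim (R ⧸ I) + n := by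
  let s : Set B := Set.range fun j => X j - algebraMap R B (c j)
  have hs : s ⊆ Q := by
    rintro _ ⟨j, rfl⟩
    exact hQ j
  let π : R →ₐ[R] B ⧸ Ideal.span s := Algebra.ofId R _
  let q : B →ₐ[R] B ⧸ Ideal.span s := Ideal.Quotient.mkₐ R (Ideal.span s)
  have hqX : ∀ j, q (X j) = π (c j) := by
    intro j
    have : q (X j - algebraMap R B (c j)) = 0 :=
      Ideal.Quotient.eq_zero_iff_mem.mpr (Ideal.subset_span ⟨j, rfl⟩)
    rw [map_sub, sub_eq_zero] at this
    exact this
  have hπsurj : Function.Surjective π := by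
    intro z
    obtain ⟨t, rfl⟩ := Ideal.Quotient.mk_surjective z
    have ht : t ∈ Algebra.adjoin R (Set.range X) := hX ▸ Algebra.mem_top
    rw [← AlgHom.mem_range]
    change q t ∈ π.range
    induction ht using Algebra.adjoin_induction with
    | mem x hx => obtain ⟨j, rfl⟩ := hx; exact ⟨c j, (hqX j).symm⟩
    | algebraMap r => rw [q.commutes]; exact Subalgebra.algebraMap_mem _ r
    | add x y _ _ hx hy => rw [map_add]; exact add_mem hx hy
    | mul x y _ _ hx hy => rw [map_mul]; exact mul_mem hx hy
  have hπI : ∀ b ∈ I, (π : R →+* B ⧸ Ideal.span s) b = 0 := by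
    intro b hb
    obtain ⟨r, hr, rfl⟩ := hI b hb
    have h0 : q (∑ j, r j • X j) = 0 := by rw [hr, map_zero]
    simp only [map_sum, map_smul, hqX] at h0
    rw [map_sum, ← h0]
    exact Finset.sum_congr rfl fun j _ => map_smul π (r j) (c j)
  refine (Ideal.height_le_ringKrullDim_quotient_add_encard s hs).trans ?_
  gcongr
  · exact ringKrullDim_le_of_surjective (Ideal.Quotient.lift I _ hπI)
      (Ideal.Quotient.lift_surjective_of_surjective _ _ hπsurj)
  · have : s.encard ≤ n := by
      have := Set.encard_image_le (fun j => X j - algebraMap R B (c j)) Set.univ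
      simpa [s, Set.image_univ] using this
    exact_mod_cast this

theorem height_add_rank_le {R : Type*} [CommRing R] [IsNoetherianRing R] [IsLocalRing R]
    (hequi : IsEquidimensionalRing R) (hcat : IsUniversallyCatenaryRing R)
    {M : Type*} [AddCommGroup M] [Module R M] {e : ℕ} (he : ModuleHasRank R M e)
    {n : ℕ} (x : Fin n → M) (hx : Submodule.span R (Set.range x) = ⊤)
    (α : SymmetricAlgebra R M →ₐ[R] IsLocalRing.ResidueField R)
    (hα : symTorsionIdeal R M ≤ RingHom.ker α) (c : Fin n → R)
    (hc : ∀ j, IsLocalRing.residue R (c j) = α (SymmetricAlgebra.ι R M (x j))) :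
    Ideal.height ((LinearMap.ker (Fintype.linearCombination R x)).map
      (Fintype.linearCombination R c) : Ideal R) + e ≤ n := by
  obtain ⟨p, hp, g, hg, hle⟩ := exists_minimalPrime_ker_symToMvPolynomial_le he α hα
  have hprime : p.IsPrime := hp.1.1
  set k := IsLocalRing.ResidueField R
  set I : Ideal R := (LinearMap.ker (Fintype.linearCombination R x)).map
      (Fintype.linearCombination R c)
  let D := R ⧸ p
  let κ := FractionRing D
  let T := MvPolynomial (Fin n) D
  have hlocal : IsLocalRing D := .of_surjective' (Ideal.Quotient.mk p) Ideal.Quotient.mk_surjective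
  let algDk : Algebra D k := (Ideal.Quotient.lift p (algebraMap R k) fun a ha =>
    (IsLocalRing.residue_eq_zero_iff a).mpr (IsLocalRing.le_maximalIdeal hprime.ne_top ha)).toAlgebra
  have htower : IsScalarTower R D k := .of_algebraMap_eq fun _ => rfl
  have hsurj : Function.Surjective (algebraMap D k) := fun y => by
    obtain ⟨r, rfl⟩ := IsLocalRing.residue_surjective y
    exact ⟨Ideal.Quotient.mk p r, rfl⟩
  -- `RingHom.ker fQ` is the point `α` seen in affine space over `D`; `RingHom.ker fq` defines the
  -- component through it.
  let fQ : T →ₐ[D] k := MvPolynomial.aeval fun j => α (SymmetricAlgebra.ι R M (x j))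
  let fq : T →ₐ[D] MvPolynomial (Fin e) κ := MvPolynomial.aeval fun j => linearForm κ e (g (x j))
  let a : MvPolynomial (Fin n) R →ₐ[R] SymmetricAlgebra R M :=
    MvPolynomial.aeval fun j => SymmetricAlgebra.ι R M (x j)
  have hmapsurj : Function.Surjective (MvPolynomial.map (σ := Fin n) (Ideal.Quotient.mk p)) :=
    MvPolynomial.map_surjective _ Ideal.Quotient.mk_surjective
  have hq_eq : ∀ t, fq (MvPolynomial.map (algebraMap R D) t) = symToMvPolynomial g (a t) := by
    intro t
    rw [MvPolynomial.aeval_map_algebraMap, ← AlgHom.comp_apply]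
    congr 1
    apply MvPolynomial.algHom_ext
    intro j
    simp [a, κ, D]
  have hQ_eq : ∀ t, fQ (MvPolynomial.map (algebraMap R D) t) = α (a t) := by
    intro t
    rw [MvPolynomial.aeval_map_algebraMap, ← AlgHom.comp_apply]
    congr 1
    ext; simp [a]
  have hqQ : RingHom.ker fq ≤ RingHom.ker fQ := by
    intro t ht
    obtain ⟨t, rfl⟩ := hmapsurj t
    have h1 : symToMvPolynomial g (a t) = 0 := by rw [← hq_eq]; exact ht
    exact (hQ_eq t).trans (hle h1)
  have hspan : Submodule.span κ (Set.range fun j => g (x j)) = ⊤ := by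
    rw [← top_le_iff, ← hg, Submodule.span_le]
    rintro _ ⟨m, rfl⟩
    have hm : m ∈ Submodule.span R (Set.range x) := hx ▸ Submodule.mem_top
    induction hm using Submodule.span_induction with
    | mem m hm => obtain ⟨j, rfl⟩ := hm; exact Submodule.subset_span ⟨j, rfl⟩
    | zero => simp
    | add y z _ _ hy hz => rw [map_add]; exact add_mem hy hz
    | smul r y _ hy =>
      rw [map_smul, ← algebraMap_smul κ]
      exact Submodule.smul_mem _ _ hy
  have hprimeq : (RingHom.ker fq).IsPrime := RingHom.ker_isPrime fq
  have hprimeQ : (RingHom.ker fQ).IsPrime := RingHom.ker_isPrime fQ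
  have hprimeQ' : ((RingHom.ker fQ).map (Ideal.Quotient.mk (RingHom.ker fq))).IsPrime :=
    Ideal.isPrime_map_quotientMk_of_isPrime hqQ
  have h1 : (RingHom.ker fq).height + e ≤ n := height_ker_aeval_linearForm_add_le _ hspan
  have h2 := height_le_height_add_of_isCatenaryRing (hcat T inferInstance) _ _ hqQ
  rw [height_ker_mvPolynomial hsurj n fQ] at h2
  have hmax : RingHom.ker (algebraMap D k) = IsLocalRing.maximalIdeal D :=
    IsLocalRing.eq_maximalIdeal (RingHom.ker_isMaximal_of_surjective _ hsurj)
  have h3 : (((RingHom.ker fQ).map (Ideal.Quotient.mk (RingHom.ker fq))).height : WithBot ℕ∞) ≤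
      ringKrullDim (R ⧸ I) + n := by
    let X (j : Fin n) : T ⧸ RingHom.ker fq := Ideal.Quotient.mk _ (MvPolynomial.X j)
    refine height_le_ringKrullDim_quotient_add_of_linear X ?_ c _ (fun j => ?_) I ?_
    · refine (Algebra.adjoin_range_eq_range_aeval R X).trans ((AlgHom.range_eq_top _).mpr ?_)
      intro z
      obtain ⟨t, rfl⟩ := Ideal.Quotient.mk_surjective z
      obtain ⟨t, rfl⟩ := hmapsurj t
      have : MvPolynomial.aeval X = (Ideal.Quotient.mkₐ R (RingHom.ker fq)).comp
          (MvPolynomial.mapAlgHom (Algebra.ofId R D)) := by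
        apply MvPolynomial.algHom_ext
        intro j
        rw [MvPolynomial.aeval_X]
        exact congrArg (Ideal.Quotient.mk (RingHom.ker fq)) (MvPolynomial.map_X _ j).symm
      exact ⟨t, DFunLike.congr_fun this t⟩
    · have : (MvPolynomial.X j - MvPolynomial.C (Ideal.Quotient.mk p (c j)) : T) ∈
          RingHom.ker fQ := by
        rw [RingHom.mem_ker, map_sub, MvPolynomial.aeval_X, ← MvPolynomial.algebraMap_eq,
          AlgHom.commutes, ← hc, sub_eq_zero]
        rfl
      exact Ideal.mem_map_of_mem _ this
    · rintro _ ⟨r, hr, rfl⟩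
      have hr' : ∑ j, r j • x j = 0 := hr
      refine ⟨r, ?_, rfl⟩
      have h := hq_eq (∑ j, r j • MvPolynomial.X j)
      have h' : a (∑ j, r j • MvPolynomial.X j) = 0 := by
        simp only [map_sum, map_smul, a, MvPolynomial.aeval_X]
        rw [← map_zero (SymmetricAlgebra.ι R M), ← hr']
        simp
      rw [h', map_zero] at h
      have h2 : MvPolynomial.map (algebraMap R D) (∑ j, r j • MvPolynomial.X j) =
          (∑ j, r j • MvPolynomial.X j : T) := by
        simp [Algebra.smul_def, MvPolynomial.algebraMap_eq]
      rw [h2] at h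
      have h3 : (Ideal.Quotient.mkₐ R (RingHom.ker fq)) (∑ j, r j • MvPolynomial.X j) = 0 :=
        Ideal.Quotient.eq_zero_iff_mem.mpr h
      rw [map_sum] at h3
      exact (Finset.sum_congr rfl fun j _ => 
        (map_smul (Ideal.Quotient.mkₐ R (RingHom.ker fq)) (r j) _).symm).trans h3
  -- Equidimensionality lets `dim R` be replaced by the height of the maximal ideal of `D`.
  have h4 := height_add_ringKrullDim_quotient_le I
  rw [← hequi p hp, ← IsLocalRing.maximalIdeal_height_eq_ringKrullDim (R := D)] at h4
  rw [hmax] at h2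
  exact rank_arith Ideal.height_ne_top_of_isPrime h1 h2 h3 h4

/-! ### Points of the special fiber and generators adapted to them. -/

/-- Nullstellensatz: the nilradical is the Jacobson radical, so some maximal ideal misses `z`; its
residue field is finite over `k`, hence equal to `k`. -/
theorem exists_algHom_ne_zero_of_not_isNilpotent {k F : Type*} [Field k] [IsAlgClosed k]
    [CommRing F] [Algebra k F] [Algebra.FiniteType k F] {z : F} (hz : ¬ IsNilpotent z) :
    ∃ β : F →ₐ[k] k, β z ≠ 0 := by
  have : IsJacobsonRing F := isJacobsonRing_of_finiteType (A := k)
  have h : z ∉ (⊥ : Ideal F).jacobson := by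
    rwa [← Ideal.radical_eq_jacobson]
  simp only [Ideal.jacobson, Ideal.mem_sInf, not_forall] at h
  obtain ⟨m, ⟨-, hm⟩, hzm⟩ := h
  let _ := Ideal.Quotient.field m
  have : Module.Finite k (F ⧸ m) := finite_of_finite_type_of_isJacobsonRing k (F ⧸ m)
  let e := AlgEquiv.ofBijective (Algebra.ofId k (F ⧸ m))
    IsAlgClosed.algebraMap_bijective_of_isIntegral
  refine ⟨e.symm.toAlgHom.comp (Ideal.Quotient.mkₐ k m), fun h0 => hzm ?_⟩
  have h1 : e.symm (Ideal.Quotient.mk m z) = 0 := h0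
  exact Ideal.Quotient.eq_zero_iff_mem.mp ((map_eq_zero_iff _ e.symm.injective).mp h1)

theorem exists_basis_dual_subset {k V : Type*} [Field k] [AddCommGroup V] [Module k V]
    [FiniteDimensional k V] (Λ : Set (Module.Dual k V)) :
    ∃ (w : Module.Basis (Fin (Module.finrank k V)) k V) (I : Finset (Fin (Module.finrank k V))),
      I.card = Module.finrank k (Submodule.span k Λ) ∧
      ∀ i ∈ I, ∃ f ∈ Λ, ∀ j, f (w j) = if j = i then 1 else 0 := by
  classical
  obtain ⟨b, hbΛ, hspan, hli⟩ := exists_linearIndependent k Λ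
  have hli' : LinearIndepOn k id b := hli
  let B := Module.Basis.extend hli'
  have := Module.Finite.finite_basis B
  have := Fintype.ofFinite (hli'.extend (Set.subset_univ b))
  have hcard : Fintype.card (hli'.extend (Set.subset_univ b)) = Module.finrank k V := by
    rw [← Module.finrank_eq_card_basis B, Subspace.dual_finrank_eq]
  let σ := Fintype.equivFinOfCardEq hcard
  -- `B` is a basis of the dual extending a maximal independent subset of `Λ`; its dual basis lives
  -- in the bidual and is carried back to `V`.
  let w := (B.dualBasis.map (Module.evalEquiv k V).symm).reindex σ
  have hw : ∀ i j, (σ.symm i : Module.Dual k V) (w j) = if j = i then 1 else 0 := by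
    intro i j
    have h1 : (σ.symm i : Module.Dual k V) = B (σ.symm i) := by simp [B]
    simp only [w, h1, Module.Basis.reindex_apply, Module.Basis.map_apply,
      Module.apply_evalEquiv_symm_apply, Module.Basis.coe_dualBasis, Module.Basis.coord_apply,
      Module.Basis.repr_self, Finsupp.single_apply, EmbeddingLike.apply_eq_iff_eq]
    simp only [eq_comm]
  have hb : b ⊆ hli'.extend (Set.subset_univ b) := hli'.subset_extend _
  have hfin : b.Finite := hli'.finite
  have := hfin.fintype
  refine ⟨w, Finset.univ.image fun f : b => σ ⟨f, hb f.2⟩, ?_, ?_⟩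
  · rw [Finset.card_image_of_injective, ← hspan, finrank_span_set_eq_card hli',
      Finset.card_univ, Set.toFinset_card]
    · intro f g h
      simpa [Subtype.ext_iff] using h
  · intro i hi
    obtain ⟨f, -, rfl⟩ := Finset.mem_image.mp hi
    refine ⟨f, hbΛ f.2, fun j => ?_⟩
    have := hw (σ ⟨f, hb f.2⟩) j
    simpa using this

section

variable (R : Type*) [CommRing R] (M : Type*) [AddCommGroup M] [Module R M]

theorem finiteType_moduleReesAlgebra [Module.Finite R M] :
    Algebra.FiniteType R (ModuleReesAlgebra R M) := by
  obtain ⟨n, x, hx⟩ := Module.Finite.exists_fin (R := R) (M := M)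
  let a : MvPolynomial (Fin n) R →ₐ[R] SymmetricAlgebra R M :=
    MvPolynomial.aeval fun j => SymmetricAlgebra.ι R M (x j)
  have ha : Function.Surjective a := by
    intro y
    rw [← AlgHom.mem_range]
    induction y using SymmetricAlgebra.induction with
    | algebraMap r => exact Subalgebra.algebraMap_mem _ r
    | ι m =>
      have hm : m ∈ Submodule.span R (Set.range x) := hx ▸ Submodule.mem_top
      induction hm using Submodule.span_induction with
      | mem m hm => obtain ⟨j, rfl⟩ := hm; exact ⟨MvPolynomial.X j, by simp [a]⟩
      | zero => simp
      | add y z _ _ hy hz => rw [map_add]; exact add_mem hy hz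
      | smul r y _ hy => rw [map_smul]; exact Subalgebra.smul_mem _ hy r
    | mul y z hy hz => exact mul_mem hy hz
    | add y z hy hz => exact add_mem hy hz
  exact Algebra.FiniteType.of_surjective ((Ideal.Quotient.mkₐ R (symTorsionIdeal R M)).comp a)
    (Ideal.Quotient.mk_surjective.comp ha)

variable [IsLocalRing R]

instance [Module.Finite R M] :
    Algebra.FiniteType (IsLocalRing.ResidueField R) (SpecialFiber R M) :=
  have := finiteType_moduleReesAlgebra R M
  inferInstanceAs (Algebra.FiniteType (IsLocalRing.ResidueField R)
    (IsLocalRing.ResidueField R ⊗[R] ModuleReesAlgebra R M))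

/-- The inclusion of the degree-one part, as a map from `k ⊗ M`. -/
noncomputable def tensorToSpecialFiber :
    (IsLocalRing.ResidueField R ⊗[R] M) →ₗ[IsLocalRing.ResidueField R] SpecialFiber R M :=
  ((Ideal.Quotient.mkₐ R (symTorsionIdeal R M)).toLinearMap ∘ₗ
    SymmetricAlgebra.ι R M).baseChange (IsLocalRing.ResidueField R)

theorem reducedSpecialFiberDegreeOne_eq_range : reducedSpecialFiberDegreeOne R M =
    LinearMap.range ((Ideal.Quotient.mkₐ (IsLocalRing.ResidueField R)
      (nilradical (SpecialFiber R M))).toLinearMap ∘ₗ tensorToSpecialFiber R M) := by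
  set φ := (Ideal.Quotient.mkₐ (IsLocalRing.ResidueField R)
      (nilradical (SpecialFiber R M))).toLinearMap ∘ₗ tensorToSpecialFiber R M
  have hsurj := TensorProduct.mk_surjective R M (IsLocalRing.ResidueField R)
    IsLocalRing.residue_surjective
  have : (Set.range fun x : M =>
      Ideal.Quotient.mk (nilradical (SpecialFiber R M)) (toSpecialFiber R M x)) =
      Set.range φ := by
    rw [← hsurj.range_comp φ]
    rfl
  rw [reducedSpecialFiberDegreeOne, this, ← LinearMap.coe_range, Submodule.span_eq]

/-- The point of `Spec Sym(M)` given by a point of the special fiber. -/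
noncomputable def symOfSpecialFiber
    (β : SpecialFiber R M →ₐ[IsLocalRing.ResidueField R] IsLocalRing.ResidueField R) :
    SymmetricAlgebra R M →ₐ[R] IsLocalRing.ResidueField R :=
  let β' : (IsLocalRing.ResidueField R ⊗[R] ModuleReesAlgebra R M)
    →ₐ[IsLocalRing.ResidueField R] IsLocalRing.ResidueField R := β
  (β'.restrictScalars R).comp
    (Algebra.TensorProduct.includeRight.comp (Ideal.Quotient.mkₐ R (symTorsionIdeal R M)))

theorem symOfSpecialFiber_ι
    (β : SpecialFiber R M →ₐ[IsLocalRing.ResidueField R] IsLocalRing.ResidueField R) (x : M) :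
    symOfSpecialFiber R M β (SymmetricAlgebra.ι R M x) =
      β (tensorToSpecialFiber R M (1 ⊗ₜ x)) := rfl

theorem symTorsionIdeal_le_ker_symOfSpecialFiber
    (β : SpecialFiber R M →ₐ[IsLocalRing.ResidueField R] IsLocalRing.ResidueField R) :
    symTorsionIdeal R M ≤ RingHom.ker (symOfSpecialFiber R M β) := by
  intro x hx
  have : Ideal.Quotient.mkₐ R (symTorsionIdeal R M) x = 0 := Ideal.Quotient.eq_zero_iff_mem.mpr hx
  rw [RingHom.mem_ker, symOfSpecialFiber, AlgHom.comp_apply, AlgHom.comp_apply, this, map_zero,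
    map_zero]

theorem minGens_eq_finrank [Module.Finite R M] : minGens R M =
    Module.finrank (IsLocalRing.ResidueField R) (IsLocalRing.ResidueField R ⊗[R] M) := by
  rw [minGens, ← TensorProduct.spanFinrank_top_eq_of_residueField (⊤ : Submodule R M)
    Module.Finite.fg_top, ← Module.finrank_eq_spanFinrank_of_free]
  exact (Submodule.topEquiv.baseChange R (IsLocalRing.ResidueField R) _ _).finrank_eq

theorem exists_generators_with_points [Module.Finite R M]
    [IsAlgClosed (IsLocalRing.ResidueField R)] :
    ∃ (x : Fin (minGens R M) → M) (I : Finset (Fin (minGens R M))),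
      Submodule.span R (Set.range x) = ⊤ ∧ I.card = reducedFiberRank R M ∧
      ∀ i ∈ I, ∃ α : SymmetricAlgebra R M →ₐ[R] IsLocalRing.ResidueField R,
        symTorsionIdeal R M ≤ RingHom.ker α ∧
        ∀ j, α (SymmetricAlgebra.ι R M (x j)) = if j = i then 1 else 0 := by
  set k := IsLocalRing.ResidueField R
  let u := tensorToSpecialFiber R M
  let Λ : Set (Module.Dual k (k ⊗[R] M)) :=
    Set.range fun β : SpecialFiber R M →ₐ[k] k => β.toLinearMap ∘ₗ u
  obtain ⟨w, I, hI, hw⟩ := exists_basis_dual_subset Λ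
  rw [minGens_eq_finrank]
  have hsurj := TensorProduct.mk_surjective R M k IsLocalRing.residue_surjective
  choose x hx using fun j => hsurj (w j)
  refine ⟨x, I, IsLocalRing.span_eq_top_of_tmul_eq_basis x w hx, ?_, fun i hi => ?_⟩
  · set φ := (Ideal.Quotient.mkₐ k (nilradical (SpecialFiber R M))).toLinearMap ∘ₗ u
    -- A vector killed by every point is nilpotent in the fiber, and conversely. Rank-nullity then
    -- identifies `dim (span Λ)` with the rank of `φ`.
    have hker : (Submodule.span k Λ).dualCoannihilator = LinearMap.ker φ := by
      ext v
      rw [Submodule.mem_dualCoannihilator, LinearMap.mem_ker]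
      have h1 : φ v = 0 ↔ IsNilpotent (u v) := Ideal.Quotient.eq_zero_iff_mem
      rw [h1]
      constructor
      · intro h
        by_contra hn
        obtain ⟨β, hβ⟩ := exists_algHom_ne_zero_of_not_isNilpotent (k := k) hn
        exact hβ (h _ (Submodule.subset_span ⟨β, rfl⟩))
      · intro h f hf
        induction hf using Submodule.span_induction with
        | mem f hf => obtain ⟨β, rfl⟩ := hf; exact (h.map β).eq_zero
        | zero => rfl
        | add f g _ _ hf hg => simp [hf, hg]
        | smul a f _ hf => simp [hf]
    have h2 := LinearMap.finrank_range_add_finrank_ker φ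
    have h3 := Subspace.finrank_add_finrank_dualCoannihilator_eq (Submodule.span k Λ)
    rw [hker] at h3
    rw [reducedFiberRank, reducedSpecialFiberDegreeOne_eq_range, hI]
    change _ = Module.finrank k (LinearMap.range φ)
    exact Nat.add_right_cancel (h3.trans h2.symm)
  · obtain ⟨_, ⟨β, rfl⟩, hβ⟩ := hw i hi
    refine ⟨symOfSpecialFiber R M β, symTorsionIdeal_le_ker_symOfSpecialFiber R M β, fun j => ?_⟩
    rw [symOfSpecialFiber_ι, ← hβ j, ← hx j]
    rfl

end

/-! ### The presentation matrix. -/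

theorem theorem2p6 {R : Type*} [CommRing R] [IsNoetherianRing R] [IsLocalRing R]
    [IsAlgClosed (IsLocalRing.ResidueField R)]
    (hequi : IsEquidimensionalRing R) (hcat : IsUniversallyCatenaryRing R)
    {M : Type*} [AddCommGroup M] [Module R M] [Module.Finite R M]
    (e : ℕ) (he : ModuleHasRank R M e) :
    ∃ (n m : ℕ) (φ : Matrix (Fin n) (Fin m) R), IsMinimalPresentationMatrix M φ ∧
      ∃ I : Finset (Fin n), I.card = reducedFiberRank R M ∧
        ∀ i ∈ I, (matrixRowIdeal φ i).height ≤ ((minGens R M - e : ℕ) : ℕ∞) := by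
  classical
  obtain ⟨x, I, hx, hI, hα⟩ := exists_generators_with_points R M
  let n := minGens R M
  let π : (Fin n → R) →ₗ[R] M := Fintype.linearCombination R x
  have hfg : (LinearMap.ker π).FG := IsNoetherian.noetherian _
  obtain ⟨s, hs, hspan⟩ := hfg.exists_span_finset_card_eq_spanFinrank
  let σ : Fin s.card ≃ s := s.equivFin.symm
  let φ : Matrix (Fin n) (Fin s.card) R := Matrix.of fun i j => (σ j : Fin n → R) i
  have hcols : Set.range φ.col = s := by
    change Set.range (Subtype.val ∘ σ) = _
    rw [σ.surjective.range_comp, Subtype.range_val]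
  have hrange : LinearMap.range φ.mulVecLin = LinearMap.ker π := by
    rw [Matrix.range_mulVecLin, hcols, hspan]
  refine ⟨n, s.card, φ, ⟨⟨π, LinearMap.exact_iff.mpr hrange.symm, ?_⟩, rfl, ?_⟩, I, hI, ?_⟩
  · rw [← LinearMap.range_eq_top, Fintype.range_linearCombination, hx]
  · rw [minGens, Submodule.spanFinrank_top, hrange, hs]
  · intro i hi
    obtain ⟨α, hα, hαx⟩ := hα i hi
    have h := height_add_rank_le hequi hcat he x hx α hα (fun j => if j = i then 1 else 0)
      fun j => by rw [hαx]; split_ifs <;> simp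
    -- For `c = δ_i` the functional reads off the `i`-th coordinate, and the columns of `φ` generate
    -- the relations.
    have hrow : (LinearMap.ker (Fintype.linearCombination R x)).map
        (Fintype.linearCombination R fun j => if j = i then (1 : R) else 0) =
        matrixRowIdeal φ i := by
      change (LinearMap.ker π).map _ = _
      rw [← hspan, Submodule.map_span, ← hcols, ← Set.range_comp, matrixRowIdeal, Ideal.span]
      congr 2
      ext j
      change Fintype.linearCombination R (fun j => if j = i then (1 : R) else 0) (φ.col j) = φ i j
      simp [Fintype.linearCombination_apply, Matrix.col]
    rw [hrow] at h
    have hfin : (matrixRowIdeal φ i).height ≠ ⊤ := by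
      intro h0
      rw [h0] at h
      simp at h
    lift (matrixRowIdeal φ i).height to ℕ using hfin with a
    norm_cast at h ⊢
    omega
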